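/- Conventions. A \emph{complex vector lattice} is a complexification $X_{\mathbb C}=X\oplus iX$ of a real vector lattice $X$ in which the modulus $|x+iy|=\sup_{\theta\in[0,2\pi]}(x\cos\theta+y\sin\theta)$ exists in $X$ for all $x,y\in X$; it is called Archimedean if $X$ is Archimedean. A \emph{complex vector lattice homomorphism} is a $\mathbb C$-linear map $T:X_{\mathbb C}\to Y_{\mathbb C}$ between complex vector lattices with $T|z|=|Tz|$ for all $z\in X_{\mathbb C}$. A \emph{complex vector sublattice} of $X_{\mathbb C}$ is a complex linear subspace that is invariant under conjugation $x+iy\mapsto x-iy$ and contains $|z|$ whenever it contains $z$; it has the form $E\oplus iE$ for a real vector sublattice $E$ of $X$, and it is itself a complex vector lattice, with the same modulus. A \emph{free complex vector lattice} over a set $A$ is a complex vector lattice $F_{\mathbb C}$ with a map $\iota:A\to F_{\mathbb C}$ such that for every complex vector lattice $V_{\mathbb C}$ and every map $T:A\to V_{\mathbb C}$ there is a unique complex vector lattice homomorphism $\hat T:F_{\mathbb C}\to V_{\mathbb C}$ with $\hat T\circ\iota=T$. A \emph{free Archimedean complex vector lattice} over $A$ is an Archimedean $F_{\mathbb C}$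 with a map $\iota:A\to F_{\mathbb C}$ that has this property for all Archimedean $V_{\mathbb C}$. Proposition. Let $A$ be a non-empty set. (1) A free complex vector lattice over $A$ exists. (2) Let $\pm A=A\sqcup\{-x:x\in A\}$ be the disjoint union of $A$ and a set of formal negatives, and for $p,q\in\pm A$ let $\eta_{(p,q)}:\mathbb R^{\pm A\times\pm A}\to\mathbb R$ be the coordinate function $\eta_{(p,q)}(f)=f(p,q)$. Let $\mathcal F$ be the vector lattice of all functions $\mathbb R^{\pm A\times\pm A}\to\mathbb R$ with the pointwise order. The complex vector sublattice of $\mathcal F\oplus i\mathcal F$ generated by the elements $\eta_{(x,x)}+i\eta_{(-x,x)}$, $x\in A$, together with the map $\iota(x)=\eta_{(x,x)}+i\eta_{(-x,x)}$, is the free Archimedean complex vector lattice over $A$. -/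

import Mathlib

universe u v

/-- The complexification `X ⊕ iX` of a real vector space `X`; `⟨x, y⟩` stands for `x + iy`. -/
@[ext]
structure Cplx (X : Type*) where
  re : X
  im : X

namespace Cplx

section Algebra

variable {X : Type*} [AddCommGroup X]

instance : Zero (Cplx X) := ⟨⟨0, 0⟩⟩
instance : Add (Cplx X) := ⟨fun z w => ⟨z.re + w.re, z.im + w.im⟩⟩
instance : Neg (Cplx X) := ⟨fun z => ⟨-z.re, -z.im⟩⟩

@[simp] theorem zero_re : (0 : Cplx X).re = 0 := rfl
@[simp] theorem zero_im : (0 : Cplx X).im = 0 := rfl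
@[simp] theorem add_re (z w : Cplx X) : (z + w).re = z.re + w.re := rfl
@[simp] theorem add_im (z w : Cplx X) : (z + w).im = z.im + w.im := rfl
@[simp] theorem neg_re (z : Cplx X) : (-z).re = -z.re := rfl
@[simp] theorem neg_im (z : Cplx X) : (-z).im = -z.im := rfl

instance : AddCommGroup (Cplx X) where
  add_assoc a b c := by ext <;> simp [add_assoc]
  zero_add a := by ext <;> simp
  add_zero a := by ext <;> simp
  add_comm a b := by ext <;> simp [add_comm]
  neg_add_cancel a := by ext <;> simp
  nsmul := nsmulRec
  zsmul := zsmulRec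

variable [Module ℝ X]

instance : SMul ℂ (Cplx X) :=
  ⟨fun c z => ⟨c.re • z.re - c.im • z.im, c.re • z.im + c.im • z.re⟩⟩

@[simp] theorem smul_re (c : ℂ) (z : Cplx X) : (c • z).re = c.re • z.re - c.im • z.im := rfl
@[simp] theorem smul_im (c : ℂ) (z : Cplx X) : (c • z).im = c.re • z.im + c.im • z.re := rfl

instance : Module ℂ (Cplx X) where
  one_smul z := by ext <;> simp
  mul_smul c d z := by ext <;> simp <;> module
  smul_zero c := by ext <;> simp
  smul_add c z w := by ext <;> simp <;> module
  add_smul c d z := by ext <;> simp <;> module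
  zero_smul z := by ext <;> simp

/-- The inclusion of `X` in `X ⊕ iX`, sending `x` to `x + i0`. -/
def ofReal (x : X) : Cplx X := ⟨x, 0⟩

/-- Conjugation, sending `x + iy` to `x - iy`. -/
def conj (z : Cplx X) : Cplx X := ⟨z.re, -z.im⟩

/-- The set `{x cos θ + y sin θ : θ ∈ [0, 2π]}`, for `z = x + iy`. -/
def rotations (z : Cplx X) : Set X :=
  (fun θ : ℝ => Real.cos θ • z.re + Real.sin θ • z.im) '' Set.Icc 0 (2 * Real.pi)

end Algebra

end Cplx

/-- `X` is a real vector lattice in which `sup {x cos θ + y sin θ : θ ∈ [0, 2π]}` exists for all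
`x` and `y`, that is, the complexification `X ⊕ iX` is a complex vector lattice. -/
class IsComplexVectorLattice (X : Type*) [AddCommGroup X] [Lattice X] [Module ℝ X] : Prop
    extends IsOrderedAddMonoid X, IsOrderedModule ℝ X where
  exists_modulus : ∀ z : Cplx X, ∃ m : X, IsLUB z.rotations m

/-- The real vector lattice `X` is Archimedean: if `n x ≤ y` for all `n`, then `x ≤ 0`. -/
def IsArchimedeanVL (X : Type*) [AddCommGroup X] [Lattice X] : Prop :=
  ∀ x y : X, (∀ n : ℕ, n • x ≤ y) → x ≤ 0

section Modulus

variable {X : Type*} [AddCommGroup X] [Lattice X] [Module ℝ X] [IsComplexVectorLattice X]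

/-- The modulus `|x + iy| = sup {x cos θ + y sin θ : θ ∈ [0, 2π]}`. -/
noncomputable def Cplx.modulus (z : Cplx X) : X :=
  (IsComplexVectorLattice.exists_modulus z).choose

theorem Cplx.isLUB_modulus (z : Cplx X) : IsLUB z.rotations z.modulus :=
  (IsComplexVectorLattice.exists_modulus z).choose_spec

theorem Cplx.modulus_ofReal (x : X) : (Cplx.ofReal x).modulus = |x| := by
  refine (Cplx.isLUB_modulus _).unique ⟨?_, ?_⟩
  · rintro _ ⟨θ, -, rfl⟩
    simp only [Cplx.ofReal, smul_zero, add_zero]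
    have h1 : 0 ≤ 1 - Real.cos θ := by linarith [Real.cos_le_one θ]
    have h2 : 0 ≤ 1 + Real.cos θ := by linarith [Real.neg_one_le_cos θ]
    have h3 := add_le_add
      (smul_le_smul_of_nonneg_left (le_abs_self x) h2)
      (smul_le_smul_of_nonneg_left (neg_le_abs x) h1)
    have h4 := smul_le_smul_of_nonneg_left h3 (by norm_num : (0 : ℝ) ≤ 1 / 2)
    convert h4 using 1 <;> module
  · intro m hm
    refine sup_le ?_ ?_
    · have := hm ⟨0, ⟨le_rfl, by positivity⟩, rfl⟩
      simpa [Cplx.ofReal] using this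
    · have := hm ⟨Real.pi, ⟨by positivity, by linarith [Real.pi_pos]⟩, rfl⟩
      simpa [Cplx.ofReal] using this

end Modulus

/-- A complex vector lattice homomorphism `X ⊕ iX → Y ⊕ iY`: a `ℂ`-linear map that preserves the
modulus, `T |z| = |T z|`. -/
structure CVLHom (X Y : Type*) [AddCommGroup X] [Lattice X] [Module ℝ X] [IsComplexVectorLattice X]
    [AddCommGroup Y] [Lattice Y] [Module ℝ Y] [IsComplexVectorLattice Y]
    extends Cplx X →ₗ[ℂ] Cplx Y where
  map_modulus : ∀ z : Cplx X, toFun (Cplx.ofReal z.modulus) = Cplx.ofReal (toFun z).modulus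

/-- The universal property of the free complex vector lattice `(X ⊕ iX, ι)` over `A`, tested on all
complex vector lattices in the universe `v`. -/
def IsFreeCVL {A : Type*} {X : Type*} [AddCommGroup X] [Lattice X] [Module ℝ X]
    [IsComplexVectorLattice X] (ι : A → Cplx X) : Prop :=
  ∀ (V : Type v) [AddCommGroup V] [Lattice V] [Module ℝ V] [IsComplexVectorLattice V]
    (T : A → Cplx V), ∃! S : CVLHom X V, ∀ a, S.toLinearMap (ι a) = T a

/-- The pair `(X ⊕ iX, ι)` is the free Archimedean complex vector lattice over `A`: `X` is
Archimedean, and the universal property holds for all Archimedean complex vector lattices in the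
universe `v`. -/
def IsFreeArchimedeanCVL {A : Type*} {X : Type*} [AddCommGroup X] [Lattice X] [Module ℝ X]
    [IsComplexVectorLattice X] (ι : A → Cplx X) : Prop :=
  IsArchimedeanVL X ∧
  ∀ (V : Type v) [AddCommGroup V] [Lattice V] [Module ℝ V] [IsComplexVectorLattice V],
    IsArchimedeanVL V →
    ∀ T : A → Cplx V, ∃! S : CVLHom X V, ∀ a, S.toLinearMap (ι a) = T a

/-- A complex vector sublattice of `X ⊕ iX`: a conjugation invariant complex subspace which
contains `|z|` whenever it contains `z`. -/
structure ComplexSublattice (X : Type*) [AddCommGroup X] [Lattice X] [Module ℝ X]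
    [IsComplexVectorLattice X] extends Submodule ℂ (Cplx X) where
  conj_mem : ∀ z, z ∈ toSubmodule → z.conj ∈ toSubmodule
  modulus_mem : ∀ z, z ∈ toSubmodule → Cplx.ofReal z.modulus ∈ toSubmodule

section Generated

variable {X : Type*} [AddCommGroup X] [Lattice X] [Module ℝ X] [IsComplexVectorLattice X]

/-- The smallest complex vector sublattice of `X ⊕ iX` that contains `S`. -/
def latC (S : Set (Cplx X)) : ComplexSublattice X where
  toSubmodule := sInf {p | ∃ L : ComplexSublattice X, S ⊆ L.toSubmodule ∧ p = L.toSubmodule}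
  conj_mem z hz := by
    simp only [Submodule.mem_sInf] at hz ⊢
    rintro _ ⟨L, hL, rfl⟩
    exact L.conj_mem z (hz _ ⟨L, hL, rfl⟩)
  modulus_mem z hz := by
    simp only [Submodule.mem_sInf] at hz ⊢
    rintro _ ⟨L, hL, rfl⟩
    exact L.modulus_mem z (hz _ ⟨L, hL, rfl⟩)

theorem subset_latC (S : Set (Cplx X)) : S ⊆ (latC S).toSubmodule := by
  intro z hz
  simp only [latC, SetLike.mem_coe, Submodule.mem_sInf]
  rintro _ ⟨L, hL, rfl⟩
  exact hL hz

namespace ComplexSublattice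

variable (L : ComplexSublattice X)

/-- The real part `E` of a complex vector sublattice `L`, for which `L = E ⊕ iE`. -/
def realPart : Submodule ℝ X where
  carrier := {x | Cplx.ofReal x ∈ L.toSubmodule}
  zero_mem' := L.zero_mem
  add_mem' {x y} hx hy := by
    have h := L.add_mem hx hy
    have e : Cplx.ofReal x + Cplx.ofReal y = Cplx.ofReal (x + y) := by
      ext <;> simp [Cplx.ofReal]
    rwa [e] at h
  smul_mem' c x hx := by
    have h := L.smul_mem (c : ℂ) hx
    have e : (c : ℂ) • Cplx.ofReal x = Cplx.ofReal (c • x) := by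
      ext <;> simp [Cplx.ofReal, -Complex.coe_smul]
    rwa [e] at h

variable {L}

theorem abs_mem {x : X} (hx : x ∈ L.realPart) : |x| ∈ L.realPart := by
  have h := L.modulus_mem _ hx
  rwa [Cplx.modulus_ofReal] at h

theorem re_mem {z : Cplx X} (hz : z ∈ L.toSubmodule) : z.re ∈ L.realPart := by
  have h := L.smul_mem (1 / 2 : ℂ) (L.add_mem hz (L.conj_mem z hz))
  have e : (1 / 2 : ℂ) • (z + z.conj) = Cplx.ofReal z.re := by
    ext
    · simp [Cplx.ofReal, Cplx.conj]
      module
    · simp [Cplx.ofReal, Cplx.conj]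
  rwa [e] at h

theorem im_mem {z : Cplx X} (hz : z ∈ L.toSubmodule) : z.im ∈ L.realPart := by
  have h := re_mem (L.smul_mem (-Complex.I) hz)
  simpa using h

theorem mem_iff {z : Cplx X} :
    z ∈ L.toSubmodule ↔ z.re ∈ L.realPart ∧ z.im ∈ L.realPart := by
  refine ⟨fun h => ⟨re_mem h, im_mem h⟩, fun ⟨h1, h2⟩ => ?_⟩
  have h := L.add_mem h1 (L.smul_mem Complex.I h2)
  have e : Cplx.ofReal z.re + Complex.I • Cplx.ofReal z.im = z := by
    ext <;> simp [Cplx.ofReal]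
  rwa [e] at h

theorem sup_mem {x y : X} (hx : x ∈ L.realPart) (hy : y ∈ L.realPart) :
    x ⊔ y ∈ L.realPart := by
  have h := L.realPart.smul_mem (1 / 2 : ℝ)
    (L.realPart.add_mem (L.realPart.add_mem hx hy) (abs_mem (L.realPart.sub_mem hy hx)))
  have e : (1 / 2 : ℝ) • (x + y + |y - x|) = x ⊔ y := by
    rw [← two_nsmul_sup_eq_add_add_abs_sub, ← Nat.cast_smul_eq_nsmul ℝ, smul_smul]
    norm_num
  rwa [e] at h

theorem inf_mem {x y : X} (hx : x ∈ L.realPart) (hy : y ∈ L.realPart) :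
    x ⊓ y ∈ L.realPart := by
  have h := L.realPart.neg_mem (sup_mem (L.realPart.neg_mem hx) (L.realPart.neg_mem hy))
  rwa [neg_sup, neg_neg, neg_neg] at h

/-- The order on the real part is inherited from `X`, and so are the lattice operations. -/
instance : Lattice L.realPart :=
  Subtype.lattice (fun _ _ hx hy => sup_mem hx hy) (fun _ _ hx hy => inf_mem hx hy)

instance : IsComplexVectorLattice L.realPart where
  add_le_add_left a b h c := add_le_add_left (α := X) h c
  smul_le_smul_of_nonneg_left c hc a b h := smul_le_smul_of_nonneg_left (β := X) h hc
  smul_le_smul_of_nonneg_right a ha c d h := smul_le_smul_of_nonneg_right (β := X) h ha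
  exists_modulus z := by
    have hz : (⟨z.re, z.im⟩ : Cplx X) ∈ L.toSubmodule := mem_iff.2 ⟨z.re.2, z.im.2⟩
    have hm := Cplx.isLUB_modulus (⟨z.re, z.im⟩ : Cplx X)
    refine ⟨⟨_, L.modulus_mem _ hz⟩, ?_, ?_⟩
    · rintro _ ⟨θ, hθ, rfl⟩
      exact hm.1 ⟨θ, hθ, rfl⟩
    · intro m hm'
      refine hm.2 ?_
      rintro _ ⟨θ, hθ, rfl⟩
      exact hm' ⟨θ, hθ, rfl⟩

/-- An element `z` of `L`, as an element of `E ⊕ iE`. -/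
def mk' (z : Cplx X) (hz : z ∈ L.toSubmodule) : Cplx L.realPart :=
  ⟨⟨z.re, re_mem hz⟩, ⟨z.im, im_mem hz⟩⟩

end ComplexSublattice

end Generated

section Functions

theorem real_isLUB_rotations (z : Cplx ℝ) :
    IsLUB z.rotations (Real.sqrt (z.re ^ 2 + z.im ^ 2)) := by
  refine ⟨?_, fun m hm => ?_⟩
  · rintro _ ⟨θ, -, rfl⟩
    refine Real.le_sqrt_of_sq_le ?_
    simp only [smul_eq_mul]
    nlinarith [sq_nonneg (Real.sin θ * z.re - Real.cos θ * z.im), Real.sin_sq_add_cos_sq θ]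
  · set w : ℂ := ⟨z.re, z.im⟩ with hw
    have hn : Real.sqrt (z.re ^ 2 + z.im ^ 2) = ‖w‖ := by
      rw [Complex.norm_def, Complex.normSq_apply, hw]
      simp only [sq]
    have key : ∀ θ : ℝ, Real.cos θ = Real.cos w.arg → Real.sin θ = Real.sin w.arg →
        θ ∈ Set.Icc 0 (2 * Real.pi) → ‖w‖ ≤ m := by
      intro θ hc hs hθ
      have h := hm ⟨θ, hθ, rfl⟩
      have h1 : z.re = ‖w‖ * Real.cos w.arg := (Complex.norm_mul_cos_arg w).symm
      have h2 : z.im = ‖w‖ * Real.sin w.arg := (Complex.norm_mul_sin_arg w).symm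
      simp only [smul_eq_mul, hc, hs] at h
      rw [h1, h2] at h
      have h3 := Real.sin_sq_add_cos_sq w.arg
      calc ‖w‖ = ‖w‖ * (Real.sin w.arg ^ 2 + Real.cos w.arg ^ 2) := by rw [h3, mul_one]
        _ = _ := by ring
        _ ≤ m := h
    rw [hn]
    by_cases h0 : 0 ≤ w.arg
    · exact key w.arg rfl rfl ⟨h0, by linarith [Complex.arg_le_pi w, Real.pi_pos]⟩
    · refine key (w.arg + 2 * Real.pi) (Real.cos_add_two_pi _) (Real.sin_add_two_pi _) ⟨?_, ?_⟩
      · linarith [Complex.neg_pi_lt_arg w, Real.pi_pos]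
      · linarith

/-- The real functions on any set, with the pointwise operations and the pointwise order. -/
instance (K : Type*) : IsComplexVectorLattice (K → ℝ) where
  exists_modulus z := by
    refine ⟨fun k => Real.sqrt (z.re k ^ 2 + z.im k ^ 2), ?_⟩
    refine isLUB_pi.2 fun k => ?_
    have h := real_isLUB_rotations (⟨z.re k, z.im k⟩ : Cplx ℝ)
    have e : Function.eval k '' z.rotations = (⟨z.re k, z.im k⟩ : Cplx ℝ).rotations := by
      simp only [Cplx.rotations, Set.image_image]
      rfl
    rw [e]
    exact h

end Functions

section Realization

variable (A : Type u)

/-- The set `±A`, the disjoint union of `A` and of a set of formal negatives: `Sum.inl x` stands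
for `x`, and `Sum.inr x` stands for `-x`. -/
abbrev Signed : Type u := A ⊕ A

variable {A}

/-- The coordinate function `η_(p,q)(f) = f(p,q)` on `ℝ^(±A × ±A)`. -/
def coordFun (p q : Signed A) : (Signed A × Signed A → ℝ) → ℝ := fun f => f (p, q)

/-- The element `η_(x,x) + i η_(-x,x)`. -/
def genElem (x : A) : Cplx ((Signed A × Signed A → ℝ) → ℝ) :=
  ⟨coordFun (Sum.inl x) (Sum.inl x), coordFun (Sum.inr x) (Sum.inl x)⟩

variable (A)

/-- The complex vector sublattice generated by the elements `η_(x,x) + i η_(-x,x)`, `x ∈ A`. -/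
def fvlC : ComplexSublattice ((Signed A × Signed A → ℝ) → ℝ) := latC (Set.range genElem)

variable {A}

/-- The map `x ↦ η_(x,x) + i η_(-x,x)`, with values in the generated sublattice. -/
def fvlIota (x : A) : Cplx (fvlC A).realPart :=
  ComplexSublattice.mk' (genElem x) (subset_latC _ ⟨x, rfl⟩)

end Realization

/-! Part (1): in the product of all complex vector lattices `V` equipped with a map from `A`, take
the complex sublattice generated by the tautological elements. A coordinate projection restricts to
the required homomorphism, and homomorphisms that agree on generators agree everywhere. The product
is too large, but the sublattice consists of values of formal expressions over `A`, so it can be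
moved into the universe of `A`.

Part (2): given `T : A → V` with `V` Archimedean, generate a sublattice `G` of the product of the
function lattice with `V` by the pairs (generator of `a`, `T a`). `G` projects onto `fvlC A`, and
moduli in a product are componentwise, so if `G` is the graph of a map, that map is the required
homomorphism. It remains to show that `(0, w) ∈ G` forces `w = 0`.

Let `M` be the real span of the parts of the generators. Its first components are linear
functionals, and they determine the second components because the coordinates involved are distinct.
Every element of the sublattice spanned by `M` is a finite supremum of finite infima from `M`; by
Gordan's alternative (`exists_nonneg_sum_smul_eq_zero`) a nonpositive first component forces a
nonpositive second one. Moduli are uniform limits of finite suprema over angles, so `G` lies in the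
relatively uniform closure of that sublattice, and the Archimedean property carries the conclusion
to the closure. -/

/-! ### Moduli, generated sublattices and homomorphisms. -/

section Modulus

variable {X Y : Type*} [AddCommGroup X] [AddCommGroup Y]

/-- The additive inclusion of `X` in its complexification. -/
def Cplx.ofRealHom : X →+ Cplx X where
  toFun := Cplx.ofReal
  map_zero' := rfl
  map_add' x y := by ext <;> simp [Cplx.ofReal]

theorem Cplx.ofReal_add (x y : X) :
    Cplx.ofReal (x + y) = Cplx.ofReal x + Cplx.ofReal y := map_add Cplx.ofRealHom x y

theorem Cplx.ofReal_sub (x y : X) :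
    Cplx.ofReal (x - y) = Cplx.ofReal x - Cplx.ofReal y := map_sub Cplx.ofRealHom x y

variable [Module ℝ X] [Module ℝ Y]

theorem Cplx.image_rotations (h : X →ₗ[ℝ] Y) (z : Cplx X) :
    h '' z.rotations = Cplx.rotations ⟨h z.re, h z.im⟩ := by
  simp only [Cplx.rotations, Set.image_image, map_add, map_smul]

theorem Cplx.ofReal_smul (c : ℝ) (x : X) :
    Cplx.ofReal (c • x) = (c : ℂ) • Cplx.ofReal x := by
  ext <;> simp [Cplx.ofReal, -Complex.coe_smul]

theorem Cplx.eq_ofReal_add (z : Cplx X) :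
    z = Cplx.ofReal z.re + Complex.I • Cplx.ofReal z.im := by
  ext <;> simp [Cplx.ofReal]

variable [Lattice X] [IsComplexVectorLattice X] [Lattice Y] [IsComplexVectorLattice Y]

namespace ComplexSublattice

theorem modulus_mk_mem {L : ComplexSublattice X} {x y : X} (hx : x ∈ L.realPart)
    (hy : y ∈ L.realPart) : Cplx.modulus ⟨x, y⟩ ∈ L.realPart :=
  L.modulus_mem _ (mem_iff.2 ⟨hx, hy⟩)

theorem coe_modulus {L : ComplexSublattice X} (z : Cplx L.realPart) :
    (z.modulus : X) = (⟨z.re, z.im⟩ : Cplx X).modulus := by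
  have hm := Cplx.isLUB_modulus (⟨z.re, z.im⟩ : Cplx X)
  have h : IsLUB z.rotations ⟨_, modulus_mk_mem z.re.2 z.im.2⟩ := by
    refine ⟨?_, fun m hm' => hm.2 ?_⟩
    · rintro _ ⟨θ, hθ, rfl⟩
      exact hm.1 ⟨θ, hθ, rfl⟩
    · rintro _ ⟨θ, hθ, rfl⟩
      exact hm' ⟨θ, hθ, rfl⟩
  exact congrArg Subtype.val ((Cplx.isLUB_modulus z).unique h)

/-- The complex vector sublattice `E ⊕ iE`, for a real subspace `E` that is closed under moduli. -/
def ofRealPart (E : Submodule ℝ X) (hE : ∀ x ∈ E, ∀ y ∈ E, Cplx.modulus ⟨x, y⟩ ∈ E) :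
    ComplexSublattice X where
  carrier := {z | z.re ∈ E ∧ z.im ∈ E}
  zero_mem' := ⟨E.zero_mem, E.zero_mem⟩
  add_mem' h h' := ⟨E.add_mem h.1 h'.1, E.add_mem h.2 h'.2⟩
  smul_mem' _ _ h := ⟨E.sub_mem (E.smul_mem _ h.1) (E.smul_mem _ h.2),
    E.add_mem (E.smul_mem _ h.2) (E.smul_mem _ h.1)⟩
  conj_mem _ h := ⟨h.1, E.neg_mem h.2⟩
  modulus_mem z h := ⟨hE z.re h.1 z.im h.2, E.zero_mem⟩

end ComplexSublattice

/-- Minimality of `latC` in terms of real subspaces; every later induction over a generated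
sublattice reduces to it. -/
theorem realPart_latC_le {S : Set (Cplx X)} {E : Submodule ℝ X}
    (hE : ∀ x ∈ E, ∀ y ∈ E, Cplx.modulus ⟨x, y⟩ ∈ E) (hS : ∀ z ∈ S, z.re ∈ E ∧ z.im ∈ E) :
    (latC S).realPart ≤ E := by
  intro x hx
  have h : Cplx.ofReal x ∈ (latC S).toSubmodule := hx
  simp only [latC, Submodule.mem_sInf] at h
  exact (h _ ⟨ComplexSublattice.ofRealPart E hE, hS, rfl⟩).1

theorem re_mem_latC {S : Set (Cplx X)} {z : Cplx X} (hz : z ∈ S) :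
    z.re ∈ (latC S).realPart := ComplexSublattice.re_mem (subset_latC S hz)

theorem im_mem_latC {S : Set (Cplx X)} {z : Cplx X} (hz : z ∈ S) :
    z.im ∈ (latC S).realPart := ComplexSublattice.im_mem (subset_latC S hz)

theorem latC_range_induction {A : Type*} {g : A → Cplx X}
    {E : Submodule ℝ (latC (Set.range g)).realPart}
    (hE : ∀ x ∈ E, ∀ y ∈ E, Cplx.modulus ⟨x, y⟩ ∈ E)
    (hre : ∀ a, ⟨(g a).re, re_mem_latC ⟨a, rfl⟩⟩ ∈ E)
    (him : ∀ a, ⟨(g a).im, im_mem_latC ⟨a, rfl⟩⟩ ∈ E)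
    (x : (latC (Set.range g)).realPart) : x ∈ E := by
  have h : (latC (Set.range g)).realPart ≤ E.map (latC (Set.range g)).realPart.subtype := by
    refine realPart_latC_le ?_ ?_
    · rintro _ ⟨x, hx, rfl⟩ _ ⟨y, hy, rfl⟩
      exact ⟨_, hE x hx y hy, ComplexSublattice.coe_modulus _⟩
    · rintro _ ⟨a, rfl⟩
      exact ⟨⟨_, hre a, rfl⟩, ⟨_, him a, rfl⟩⟩
  obtain ⟨y, hy, hxy⟩ := h x.2
  rwa [← Subtype.ext hxy]

namespace CVLHom

@[ext]
theorem ext {S S' : CVLHom X Y} (h : ∀ z, S.toLinearMap z = S'.toLinearMap z) : S = S' := by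
  cases S
  cases S'
  congr
  exact LinearMap.ext h

theorem map_ofReal_modulus (S : CVLHom X Y) (z : Cplx X) :
    S.toLinearMap (Cplx.ofReal z.modulus) = Cplx.ofReal (S.toLinearMap z).modulus :=
  S.map_modulus z

theorem map_ofReal_abs (S : CVLHom X Y) (x : X) :
    S.toLinearMap (Cplx.ofReal |x|) =
      Cplx.ofReal (S.toLinearMap (Cplx.ofReal x)).modulus := by
  rw [← Cplx.modulus_ofReal]
  exact S.map_modulus _

/-- Positive elements are their own moduli, so they go to moduli, which are real; every real element
is a difference of two positive ones. -/
theorem im_map_ofReal (S : CVLHom X Y) (x : X) :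
    (S.toLinearMap (Cplx.ofReal x)).im = 0 := by
  have h : x = |x⁺| - |x⁻| := by
    rw [abs_of_nonneg (posPart_nonneg x), abs_of_nonneg (negPart_nonneg x),
      posPart_sub_negPart]
  rw [h, Cplx.ofReal_sub, map_sub, map_ofReal_abs, map_ofReal_abs, ← Cplx.ofReal_sub]
  rfl

theorem re_map (S : CVLHom X Y) (z : Cplx X) :
    (S.toLinearMap z).re = (S.toLinearMap (Cplx.ofReal z.re)).re := by
  conv_lhs => rw [Cplx.eq_ofReal_add z]
  simp [im_map_ofReal]

theorem im_map (S : CVLHom X Y) (z : Cplx X) :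
    (S.toLinearMap z).im = (S.toLinearMap (Cplx.ofReal z.im)).re := by
  conv_lhs => rw [Cplx.eq_ofReal_add z]
  simp [im_map_ofReal]

/-- The complexification of a real linear map that preserves moduli. -/
def ofReal (h : X →ₗ[ℝ] Y)
    (hm : ∀ z : Cplx X, h z.modulus = Cplx.modulus ⟨h z.re, h z.im⟩) : CVLHom X Y where
  toFun z := ⟨h z.re, h z.im⟩
  map_add' z w := by ext <;> simp
  map_smul' c z := by ext <;> simp
  map_modulus z := by
    ext
    · exact hm z
    · exact map_zero h

theorem ofReal_apply (h : X →ₗ[ℝ] Y)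
    (hm : ∀ z : Cplx X, h z.modulus = Cplx.modulus ⟨h z.re, h z.im⟩) (z : Cplx X) :
    (ofReal h hm).toLinearMap z = ⟨h z.re, h z.im⟩ := rfl

/-- The real subspace of `X` on which two homomorphisms agree. -/
def realEqLocus (S S' : CVLHom X Y) : Submodule ℝ X where
  carrier := {x | S.toLinearMap (Cplx.ofReal x) = S'.toLinearMap (Cplx.ofReal x)}
  zero_mem' := (map_zero S.toLinearMap).trans (map_zero S'.toLinearMap).symm
  add_mem' {x y} hx hy := by
    simp only [Set.mem_ofPred_eq] at hx hy ⊢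
    rw [Cplx.ofReal_add, map_add, map_add, hx, hy]
  smul_mem' c x hx := by
    simp only [Set.mem_ofPred_eq] at hx ⊢
    rw [Cplx.ofReal_smul, map_smul, map_smul, hx]

theorem mem_realEqLocus {S S' : CVLHom X Y} {x : X} :
    x ∈ realEqLocus S S' ↔ S.toLinearMap (Cplx.ofReal x) = S'.toLinearMap (Cplx.ofReal x) :=
  Iff.rfl

theorem eq_of_mem_realEqLocus {S S' : CVLHom X Y} {z : Cplx X} (hx : z.re ∈ realEqLocus S S')
    (hy : z.im ∈ realEqLocus S S') : S.toLinearMap z = S'.toLinearMap z := by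
  rw [Cplx.eq_ofReal_add z, map_add, map_add, map_smul, map_smul, mem_realEqLocus.1 hx,
    mem_realEqLocus.1 hy]

theorem modulus_mem_realEqLocus {S S' : CVLHom X Y} {x y : X} (hx : x ∈ realEqLocus S S')
    (hy : y ∈ realEqLocus S S') : Cplx.modulus ⟨x, y⟩ ∈ realEqLocus S S' := by
  rw [mem_realEqLocus, map_ofReal_modulus, map_ofReal_modulus,
    eq_of_mem_realEqLocus (z := ⟨x, y⟩) hx hy]

theorem re_mem_realEqLocus {S S' : CVLHom X Y} {z : Cplx X}
    (hz : S.toLinearMap z = S'.toLinearMap z) : z.re ∈ realEqLocus S S' := by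
  refine mem_realEqLocus.2 (Cplx.ext ?_ ?_)
  · rw [← re_map, ← re_map, hz]
  · rw [im_map_ofReal, im_map_ofReal]

theorem im_mem_realEqLocus {S S' : CVLHom X Y} {z : Cplx X}
    (hz : S.toLinearMap z = S'.toLinearMap z) : z.im ∈ realEqLocus S S' := by
  refine mem_realEqLocus.2 (Cplx.ext ?_ ?_)
  · rw [← im_map, ← im_map, hz]
  · rw [im_map_ofReal, im_map_ofReal]

/-- A homomorphism on the complex vector sublattice generated by a family is determined by its
values on that family. -/
theorem latC_ext {A : Type*} {g : A → Cplx X} {S S' : CVLHom (latC (Set.range g)).realPart Y}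
    (h : ∀ a, S.toLinearMap (ComplexSublattice.mk' (g a) (subset_latC _ ⟨a, rfl⟩)) =
      S'.toLinearMap (ComplexSublattice.mk' (g a) (subset_latC _ ⟨a, rfl⟩))) : S = S' := by
  have key : ∀ x, x ∈ realEqLocus S S' := latC_range_induction
    (fun x hx y hy => modulus_mem_realEqLocus hx hy) (fun a => re_mem_realEqLocus (h a))
    (fun a => im_mem_realEqLocus (h a))
  exact ext fun z => eq_of_mem_realEqLocus (key _) (key _)

/-- Composition of homomorphisms. -/
def comp {Z : Type*} [AddCommGroup Z] [Lattice Z] [Module ℝ Z] [IsComplexVectorLattice Z]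
    (S : CVLHom Y Z) (T : CVLHom X Y) : CVLHom X Z where
  toLinearMap := S.toLinearMap.comp T.toLinearMap
  map_modulus z := by
    change S.toLinearMap (T.toLinearMap _) = Cplx.ofReal (S.toLinearMap (T.toLinearMap z)).modulus
    rw [map_ofReal_modulus, map_ofReal_modulus]

theorem comp_apply {Z : Type*} [AddCommGroup Z] [Lattice Z] [Module ℝ Z]
    [IsComplexVectorLattice Z] (S : CVLHom Y Z) (T : CVLHom X Y) (z : Cplx X) :
    (S.comp T).toLinearMap z = S.toLinearMap (T.toLinearMap z) := rfl

end CVLHom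

end Modulus

/-! ### Componentwise moduli in products. -/

section Products

instance {I : Type*} (X : I → Type*) [∀ i, AddCommGroup (X i)] [∀ i, Lattice (X i)]
    [∀ i, Module ℝ (X i)] [∀ i, IsComplexVectorLattice (X i)] :
    IsComplexVectorLattice (∀ i, X i) where
  smul_le_smul_of_nonneg_left _ hc _ _ h i := smul_le_smul_of_nonneg_left (h i) hc
  smul_le_smul_of_nonneg_right _ ha _ _ h i := smul_le_smul_of_nonneg_right h (ha i)
  exists_modulus z := by
    refine ⟨fun i => Cplx.modulus ⟨z.re i, z.im i⟩, isLUB_pi.2 fun i => ?_⟩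
    have h := Cplx.image_rotations (LinearMap.proj i : (∀ i, X i) →ₗ[ℝ] X i) z
    exact (congrArg (IsLUB · _) h).mpr (Cplx.isLUB_modulus _)

theorem Cplx.modulus_pi_apply {I : Type*} {X : I → Type*} [∀ i, AddCommGroup (X i)]
    [∀ i, Lattice (X i)] [∀ i, Module ℝ (X i)] [∀ i, IsComplexVectorLattice (X i)]
    (z : Cplx (∀ i, X i)) (i : I) : z.modulus i = Cplx.modulus ⟨z.re i, z.im i⟩ := by
  refine (isLUB_pi.1 (Cplx.isLUB_modulus z) i).unique ?_
  have h := Cplx.image_rotations (LinearMap.proj i : (∀ i, X i) →ₗ[ℝ] X i) z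
  exact (congrArg (IsLUB · _) h).mpr (Cplx.isLUB_modulus _)

variable {X Y : Type*} [AddCommGroup X] [Lattice X] [Module ℝ X] [IsComplexVectorLattice X]
  [AddCommGroup Y] [Lattice Y] [Module ℝ Y] [IsComplexVectorLattice Y]

theorem Cplx.isLUB_rotations_prod (z : Cplx (X × Y)) :
    IsLUB z.rotations
      (Cplx.modulus ⟨z.re.1, z.im.1⟩, Cplx.modulus ⟨z.re.2, z.im.2⟩) := by
  refine isLUB_prod.2 ⟨?_, ?_⟩
  · exact (congrArg (IsLUB · _) (Cplx.image_rotations (LinearMap.fst ℝ X Y) z)).mpr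
      (Cplx.isLUB_modulus _)
  · exact (congrArg (IsLUB · _) (Cplx.image_rotations (LinearMap.snd ℝ X Y) z)).mpr
      (Cplx.isLUB_modulus _)

instance : IsComplexVectorLattice (X × Y) where
  smul_le_smul_of_nonneg_left _ hc _ _ h :=
    ⟨smul_le_smul_of_nonneg_left h.1 hc, smul_le_smul_of_nonneg_left h.2 hc⟩
  smul_le_smul_of_nonneg_right _ ha _ _ h :=
    ⟨smul_le_smul_of_nonneg_right h ha.1, smul_le_smul_of_nonneg_right h ha.2⟩
  exists_modulus z := ⟨_, Cplx.isLUB_rotations_prod z⟩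

theorem Cplx.modulus_prod (z : Cplx (X × Y)) :
    z.modulus = (Cplx.modulus ⟨z.re.1, z.im.1⟩, Cplx.modulus ⟨z.re.2, z.im.2⟩) :=
  (Cplx.isLUB_modulus z).unique (Cplx.isLUB_rotations_prod z)

end Products

/-! ### Transport of structure along a bijection. -/

section Transfer

/-- The lattice structure transported along a bijection. -/
@[reducible]
def Equiv.transportLattice {F X : Type*} [Lattice X] (e : F ≃ X) : Lattice F where
  le a b := e a ≤ e b
  le_refl a := le_refl (e a)
  le_trans a b c := le_trans (a := e a) (b := e b) (c := e c)
  le_antisymm a b h h' := e.injective (le_antisymm h h')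
  sup a b := e.symm (e a ⊔ e b)
  inf a b := e.symm (e a ⊓ e b)
  le_sup_left a b := by simp
  le_sup_right a b := by simp
  sup_le a b c h h' := by simpa using ⟨h, h'⟩
  inf_le_left a b := by simp
  inf_le_right a b := by simp
  le_inf a b c h h' := by simpa using ⟨h, h'⟩

theorem Cplx.map_modulus_of_orderIso {X Y : Type*} [AddCommGroup X] [Lattice X] [Module ℝ X]
    [IsComplexVectorLattice X] [AddCommGroup Y] [Lattice Y] [Module ℝ Y]
    [IsComplexVectorLattice Y] (e : X ≃ₗ[ℝ] Y) (he : ∀ x y, e x ≤ e y ↔ x ≤ y) (z : Cplx X) :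
    e z.modulus = Cplx.modulus ⟨e z.re, e z.im⟩ := by
  let o : X ≃o Y := { e.toEquiv with map_rel_iff' := he _ _ }
  have h : IsLUB (o '' z.rotations) (o z.modulus) := o.isLUB_image'.2 (Cplx.isLUB_modulus z)
  have h' := Cplx.image_rotations e.toLinearMap z
  exact ((congrArg (IsLUB · (e z.modulus)) h').mp h).unique (Cplx.isLUB_modulus _)

/-- The structure of a complex vector lattice can be transported along a bijection. -/
theorem Equiv.exists_isComplexVectorLattice {F X : Type*} [AddCommGroup X] [Lattice X]
    [Module ℝ X] [IsComplexVectorLattice X] (e : F ≃ X) :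
    ∃ (_ : AddCommGroup F) (_ : Lattice F) (_ : Module ℝ F) (_ : IsComplexVectorLattice F)
      (S : CVLHom F X) (S' : CVLHom X F),
      (∀ z, S.toLinearMap (S'.toLinearMap z) = z) ∧
        ∀ z, S'.toLinearMap (S.toLinearMap z) = z := by
  let _ : AddCommGroup F := e.addCommGroup
  let _ : Module ℝ F := e.module ℝ
  let _ : Lattice F := e.transportLattice
  let l : F ≃ₗ[ℝ] X := e.linearEquiv ℝ
  have hle : ∀ x y, l x ≤ l y ↔ x ≤ y := fun x y => Iff.rfl
  have hF : IsComplexVectorLattice F :=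
    { add_le_add_left := fun a b h c => by
        rw [← hle, map_add, map_add]
        exact add_le_add_left ((hle a b).2 h) _
      smul_le_smul_of_nonneg_left := fun c hc a b h => by
        change l (c • a) ≤ l (c • b)
        rw [map_smul, map_smul]
        exact smul_le_smul_of_nonneg_left ((hle a b).2 h) hc
      smul_le_smul_of_nonneg_right := fun a ha c d h => by
        change l (c • a) ≤ l (d • a)
        rw [map_smul, map_smul]
        have ha' : 0 ≤ l a := by
          rw [← map_zero l]
          exact (hle 0 a).2 ha
        exact smul_le_smul_of_nonneg_right h ha'
      exists_modulus := fun z => by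
        let o : F ≃o X := { e with map_rel_iff' := hle _ _ }
        refine ⟨o.symm (Cplx.modulus ⟨l z.re, l z.im⟩), ?_⟩
        rw [← o.isLUB_image]
        exact (congrArg (IsLUB · _) (Cplx.image_rotations l.toLinearMap z)).mpr
          (Cplx.isLUB_modulus _) }
  refine ⟨_, _, _, hF, CVLHom.ofReal l.toLinearMap (Cplx.map_modulus_of_orderIso l hle),
    CVLHom.ofReal l.symm.toLinearMap (Cplx.map_modulus_of_orderIso l.symm fun x y => ?_),
    fun z => ?_, fun z => ?_⟩
  · rw [← hle, l.apply_symm_apply, l.apply_symm_apply]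
  · simp [CVLHom.ofReal_apply]
  · simp [CVLHom.ofReal_apply]

end Transfer

/-! ### A size bound for generated sublattices. -/

section Terms

/-- Formal expressions in the real and imaginary parts of the elements of `A`. -/
inductive CVLTerm (A : Type u) : Type u
  | re (a : A)
  | im (a : A)
  | zero
  | add (s t : CVLTerm A)
  | smul (c : ℝ) (t : CVLTerm A)
  | modulus (s t : CVLTerm A)

variable {A : Type u} {X : Type*} [AddCommGroup X] [Lattice X] [Module ℝ X]
  [IsComplexVectorLattice X]

/-- The value of a formal expression. -/
noncomputable def CVLTerm.eval (g : A → Cplx X) : CVLTerm A → X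
  | re a => (g a).re
  | im a => (g a).im
  | zero => 0
  | add s t => s.eval g + t.eval g
  | smul c t => c • t.eval g
  | modulus s t => Cplx.modulus ⟨s.eval g, t.eval g⟩

theorem CVLTerm.exists_eval_eq {g : A → Cplx X} {x : X}
    (hx : x ∈ (latC (Set.range g)).realPart) : ∃ t : CVLTerm A, t.eval g = x := by
  let E : Submodule ℝ X :=
    { carrier := Set.range (CVLTerm.eval g)
      zero_mem' := ⟨zero, rfl⟩
      add_mem' := by
        rintro _ _ ⟨s, rfl⟩ ⟨t, rfl⟩
        exact ⟨add s t, rfl⟩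
      smul_mem' := by
        rintro c _ ⟨t, rfl⟩
        exact ⟨smul c t, rfl⟩ }
  have h : (latC (Set.range g)).realPart ≤ E := by
    refine realPart_latC_le ?_ ?_
    · rintro _ ⟨s, rfl⟩ _ ⟨t, rfl⟩
      exact ⟨modulus s t, rfl⟩
    · rintro _ ⟨a, rfl⟩
      exact ⟨⟨re a, rfl⟩, ⟨im a, rfl⟩⟩
  exact h hx

/-- Choosing an expression for each element injects the real part into `CVLTerm A`, which lives in
the universe of `A`. -/
theorem small_realPart_latC (g : A → Cplx X) : Small.{u} (latC (Set.range g)).realPart := by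
  choose t ht using fun x : (latC (Set.range g)).realPart => CVLTerm.exists_eval_eq x.2
  exact small_of_injective (f := t) fun x y h => Subtype.ext (by rw [← ht x, ← ht y, h])

end Terms

/-! ### Existence of the free complex vector lattice. -/

section Free

/-- A map from `A` to a complex vector lattice. -/
structure CVLValuation (A : Type u) : Type (max u (v + 1)) where
  carrier : Type v
  [addCommGroup : AddCommGroup carrier]
  [lattice : Lattice carrier]
  [module : Module ℝ carrier]
  [isComplexVectorLattice : IsComplexVectorLattice carrier]
  toFun : A → Cplx carrier

attribute [instance] CVLValuation.addCommGroup CVLValuation.lattice CVLValuation.module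
  CVLValuation.isComplexVectorLattice

variable (A : Type u)

/-- The tautological map from `A` to the product of all complex vector lattices with a map
from `A`. -/
def universalValuation (a : A) : Cplx (∀ i : CVLValuation.{u, v} A, i.carrier) :=
  ⟨fun i => (i.toFun a).re, fun i => (i.toFun a).im⟩

/-- The pair `(V, T)` is itself an index of the product, and the projection to that factor extends
`T`. -/
theorem isFreeCVL_universalValuation :
    IsFreeCVL.{v} fun a => ComplexSublattice.mk' (universalValuation.{u, v} A a)
      (subset_latC (Set.range (universalValuation A)) ⟨a, rfl⟩) := by
  intro V _ _ _ _ T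
  let i : CVLValuation.{u, v} A := ⟨V, T⟩
  let h : (latC (Set.range (universalValuation.{u, v} A))).realPart →ₗ[ℝ] V :=
    (LinearMap.proj i : (∀ i : CVLValuation.{u, v} A, i.carrier) →ₗ[ℝ] i.carrier).comp
      (Submodule.subtype _)
  refine ⟨CVLHom.ofReal h fun z => ?_, fun a => rfl, fun S hS => CVLHom.latC_ext fun a => hS a⟩
  change (z.modulus : ∀ i : CVLValuation.{u, v} A, i.carrier) i = _
  rw [ComplexSublattice.coe_modulus, Cplx.modulus_pi_apply]
  rfl

theorem exists_isFreeCVL :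
    ∃ (F : Type u) (_ : AddCommGroup F) (_ : Lattice F) (_ : Module ℝ F)
      (_ : IsComplexVectorLattice F) (ι : A → Cplx F), IsFreeCVL.{v} ι := by
  have hs := small_realPart_latC (universalValuation.{u, v} A)
  obtain ⟨i₁, i₂, i₃, i₄, S, S', hS, hS'⟩ := (equivShrink
    (latC (Set.range (universalValuation.{u, v} A))).realPart).symm.exists_isComplexVectorLattice
  refine ⟨_, i₁, i₂, i₃, i₄, fun a => S'.toLinearMap (ComplexSublattice.mk' _
    (subset_latC (Set.range (universalValuation.{u, v} A)) ⟨a, rfl⟩)), ?_⟩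
  intro V _ _ _ _ T
  obtain ⟨R, hR, hu⟩ := isFreeCVL_universalValuation.{u, v} A V T
  refine ⟨R.comp S, fun a => ?_, fun Q hQ => ?_⟩
  · rw [CVLHom.comp_apply, hS]
    exact hR a
  · have h := hu (Q.comp S') hQ
    ext1 z
    rw [← h, CVLHom.comp_apply, CVLHom.comp_apply, hS']

end Free

/-! ### Gordan's alternative. -/

section Alternative

/-- Gordan's alternative: if finitely many linear functionals are never simultaneously positive,
then a nontrivial nonnegative combination of them vanishes. -/
theorem exists_nonneg_sum_smul_eq_zero {Q ι : Type*} [AddCommGroup Q] [Module ℝ Q] [Fintype ι]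
    (f : ι → Q →ₗ[ℝ] ℝ) (hf : ∀ q, ∃ i, f i q ≤ 0) :
    ∃ c : ι → ℝ, (∀ i, 0 ≤ c i) ∧ 0 < ∑ i, c i ∧ ∑ i, c i • f i = 0 := by
  classical
  -- The open positive orthant misses the range of `f`. A separating functional `φ` vanishes on the
  -- range, and `-φ` has nonnegative coefficients, which serve as `c`.
  let P : Set (ι → ℝ) := Set.univ.pi fun _ => Set.Ioi 0
  let R : Submodule ℝ (ι → ℝ) := LinearMap.range (LinearMap.pi f)
  have hP : Convex ℝ P := convex_pi fun _ _ => convex_Ioi 0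
  have hPo : IsOpen P := isOpen_set_pi Set.finite_univ fun _ _ => isOpen_Ioi
  have hd : Disjoint P (R : Set (ι → ℝ)) := by
    rw [Set.disjoint_left]
    rintro _ hp ⟨q, rfl⟩
    obtain ⟨i, hi⟩ := hf q
    exact absurd (hp i trivial) (not_lt.2 hi)
  obtain ⟨φ, b, hφP, hφR⟩ := geometric_hahn_banach_open hP hPo R.convex hd
  have hb : b ≤ 0 := by simpa using hφR 0 R.zero_mem
  have hzero : ∀ x ∈ R, φ x = 0 := by
    intro x hx
    by_contra hne
    -- The scalar makes `φ` equal to `b - 1` on a point of the range, below the bound `b`.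
    have h := hφR _ (R.smul_mem ((b - 1) / φ x) hx)
    rw [map_smul, smul_eq_mul, div_mul_cancel₀ _ hne] at h
    linarith
  have hsum : ∀ x : ι → ℝ, φ x = ∑ i, x i * φ (Pi.single i 1) := by
    intro x
    conv_lhs => rw [pi_eq_sum_univ' x]
    simp [map_sum, map_smul]
  refine ⟨fun i => -φ (Pi.single i 1), fun i => ?_, ?_, ?_⟩
  · by_contra! h
    have hpos : 0 < φ (Pi.single i 1) := by linarith
    -- The basis vector is only on the boundary of the orthant; a small multiple of `1` pushes it
    -- inside while `φ` stays positive.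
    obtain ⟨ε, hε, hlt⟩ : ∃ ε : ℝ, 0 < ε ∧ -(ε * φ 1) < φ (Pi.single i 1) := by
      refine ⟨φ (Pi.single i 1) / (|φ 1| + 1), by positivity, ?_⟩
      have h1 : -φ 1 < |φ 1| + 1 := by linarith [neg_le_abs (φ 1)]
      calc -(φ (Pi.single i 1) / (|φ 1| + 1) * φ 1)
          = φ (Pi.single i 1) / (|φ 1| + 1) * -φ 1 := by ring
        _ < φ (Pi.single i 1) / (|φ 1| + 1) * (|φ 1| + 1) := by gcongr
        _ = φ (Pi.single i 1) := div_mul_cancel₀ _ (by positivity)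
    have hmem : Pi.single i 1 + ε • (1 : ι → ℝ) ∈ P := by
      intro j _
      have : (0 : ℝ) ≤ (Pi.single i 1 : ι → ℝ) j := by
        by_cases hij : j = i
        · subst hij; simp
        · simp [hij]
      simp only [Pi.add_apply, Pi.smul_apply, Pi.one_apply, smul_eq_mul, mul_one, Set.mem_Ioi]
      linarith
    have := hφP _ hmem
    rw [map_add, map_smul, smul_eq_mul] at this
    linarith
  · have h := hφP 1 fun _ _ => Set.mem_Ioi.2 zero_lt_one
    rw [hsum] at h
    simp only [Pi.one_apply, one_mul] at h
    rw [Finset.sum_neg_distrib]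
    linarith
  · ext q
    have h := hzero _ ⟨q, rfl⟩
    rw [hsum] at h
    simp only [LinearMap.pi_apply] at h
    simp only [LinearMap.sum_apply, LinearMap.smul_apply, smul_eq_mul, neg_mul,
      Finset.sum_neg_distrib, LinearMap.zero_apply, neg_eq_zero]
    rw [← h]
    exact Finset.sum_congr rfl fun i _ => mul_comm _ _

end Alternative

/-! ### The sublattice spanned by a subspace of linear data. -/

section LatticeLinear

variable {X : Type*} [AddCommGroup X] [Lattice X] [Module ℝ X] [IsComplexVectorLattice X]

theorem smul_sup_of_pos {c : ℝ} (hc : 0 < c) (x y : X) : c • (x ⊔ y) = c • x ⊔ c • y :=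
  (OrderIso.smulRight hc).map_sup x y

theorem smul_inf_of_pos {c : ℝ} (hc : 0 < c) (x y : X) : c • (x ⊓ y) = c • x ⊓ c • y :=
  (OrderIso.smulRight hc).map_inf x y

/-- The sublattice generated by a subspace is a subspace. -/
def Submodule.latticeSpan (M : Submodule ℝ X) : Submodule ℝ X where
  carrier := latticeClosure (M : Set X)
  zero_mem' := subset_latticeClosure M.zero_mem
  add_mem' {a b} ha hb := by
    have hL := isSublattice_latticeClosure (s := (M : Set X))
    -- Translations preserve suprema and infima, so one summand is treated at a time, starting with
    -- the other in `M`.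
    have h₁ : ∀ m ∈ M, ∀ y ∈ latticeClosure (M : Set X), m + y ∈ latticeClosure (M : Set X) := by
      intro m hm y hy
      refine latticeClosure_min (t := {y | m + y ∈ latticeClosure (M : Set X)})
        (fun y hy => subset_latticeClosure (M.add_mem hm hy)) ⟨?_, ?_⟩ hy
      · intro y hy z hz
        rw [Set.mem_ofPred_eq, add_sup]
        exact hL.1 hy hz
      · intro y hy z hz
        rw [Set.mem_ofPred_eq, add_inf]
        exact hL.2 hy hz
    refine latticeClosure_min (t := {a | a + b ∈ latticeClosure (M : Set X)})
      (fun m hm => h₁ m hm b hb) ⟨?_, ?_⟩ ha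
    · intro y hy z hz
      rw [Set.mem_ofPred_eq, sup_add]
      exact hL.1 hy hz
    · intro y hy z hz
      rw [Set.mem_ofPred_eq, inf_add]
      exact hL.2 hy hz
  smul_mem' c x hx := by
    have hL := isSublattice_latticeClosure (s := (M : Set X))
    have hpos : ∀ c : ℝ, 0 < c → ∀ x ∈ latticeClosure (M : Set X),
        c • x ∈ latticeClosure (M : Set X) := by
      intro c hc x hx
      refine latticeClosure_min (t := {x | c • x ∈ latticeClosure (M : Set X)})
        (fun m hm => subset_latticeClosure (M.smul_mem c hm)) ⟨?_, ?_⟩ hx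
      · intro y hy z hz
        rw [Set.mem_ofPred_eq, smul_sup_of_pos hc]
        exact hL.1 hy hz
      · intro y hy z hz
        rw [Set.mem_ofPred_eq, smul_inf_of_pos hc]
        exact hL.2 hy hz
    have hneg : ∀ x ∈ latticeClosure (M : Set X), -x ∈ latticeClosure (M : Set X) := by
      intro x hx
      refine latticeClosure_min (t := {x | -x ∈ latticeClosure (M : Set X)})
        (fun m hm => subset_latticeClosure (M.neg_mem hm)) ⟨?_, ?_⟩ hx
      · intro y hy z hz
        rw [Set.mem_ofPred_eq, _root_.neg_sup]
        exact hL.2 hy hz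
      · intro y hy z hz
        rw [Set.mem_ofPred_eq, _root_.neg_inf]
        exact hL.1 hy hz
    rcases lt_trichotomy c 0 with hc | rfl | hc
    · have h := hneg _ (hpos (-c) (neg_pos.2 hc) x hx)
      rwa [neg_smul, neg_neg] at h
    · rw [zero_smul]
      exact subset_latticeClosure M.zero_mem
    · exact hpos c hc x hx

theorem Submodule.supClosed_latticeSpan (M : Submodule ℝ X) :
    SupClosed (M.latticeSpan : Set X) := isSublattice_latticeClosure.1

theorem Submodule.le_latticeSpan (M : Submodule ℝ X) : M ≤ M.latticeSpan :=
  subset_latticeClosure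

/-- For an infimum of elements of `M`, Gordan's alternative gives a nontrivial nonnegative
combination with zero first component, hence zero second component. The infimum lies below each
term, so a positive multiple of its second component is at most `0`. Suprema preserve the
implication. -/
theorem Submodule.snd_nonpos_of_mem_latticeSpan {Q : Type*} [AddCommGroup Q] [Module ℝ Q]
    {M : Submodule ℝ ((Q → ℝ) × X)} (hlin : ∀ m ∈ M, ∃ l : Q →ₗ[ℝ] ℝ, m.1 = l)
    (hzero : ∀ m ∈ M, m.1 = 0 → m.2 = 0) {d : (Q → ℝ) × X} (hd : d ∈ M.latticeSpan)
    (h : d.1 ≤ 0) : d.2 ≤ 0 := by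
  -- Lattice-ordered groups are distributive, so suprema of infima exhaust the generated sublattice.
  let _ : DistribLattice ((Q → ℝ) × X) := AddCommGroup.toDistribLattice _
  have hd' : d ∈ supClosure (infClosure (M : Set ((Q → ℝ) × X))) := by
    rw [supClosure_infClosure]
    exact hd
  refine supClosure_min (t := {d : (Q → ℝ) × X | d.1 ≤ 0 → d.2 ≤ 0}) ?_ ?_ hd' h
  · rintro _ ⟨t, ht, hts, rfl⟩ hle
    choose l hl using fun m : t => hlin m (hts m.2)
    have happly : ∀ q : Q, (t.inf' ht id).1 q = t.inf' ht fun m => m.1 q := fun q =>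
      Finset.apply_inf'_eq_inf'_comp ht (fun m : (Q → ℝ) × X => m.1 q) fun _ _ => rfl
    have hf : ∀ q, ∃ m : t, l m q ≤ 0 := by
      intro q
      have h0 := hle q
      rw [happly, Pi.zero_apply, Finset.inf'_le_iff] at h0
      obtain ⟨m, hm, hmq⟩ := h0
      exact ⟨⟨m, hm⟩, by rwa [← hl ⟨m, hm⟩]⟩
    obtain ⟨c, hc, hcs, hc0⟩ := exists_nonneg_sum_smul_eq_zero l hf
    have hmem : ∑ m : t, c m • (m : (Q → ℝ) × X) ∈ M :=
      M.sum_mem fun m _ => M.smul_mem _ (hts m.2)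
    have h2 := hzero _ hmem (by
      ext q
      have := LinearMap.congr_fun hc0 q
      simpa [Prod.fst_sum, hl] using this)
    rw [Prod.snd_sum] at h2
    have h3 : (∑ m : t, c m) • (t.inf' ht id).2 ≤ 0 := by
      rw [Finset.sum_smul, ← h2]
      refine Finset.sum_le_sum fun m _ => smul_le_smul_of_nonneg_left ?_ (hc m)
      exact (Finset.inf'_le (f := id) m.2 : t.inf' ht id ≤ (m : (Q → ℝ) × X)).2
    have h4 := smul_le_smul_of_nonneg_left h3 (inv_nonneg.2 hcs.le)
    rwa [smul_smul, inv_mul_cancel₀ hcs.ne', one_smul, smul_zero] at h4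
  · intro a ha b hb hab
    exact sup_le (ha (le_sup_left.trans hab)) (hb (le_sup_right.trans hab))

end LatticeLinear

/-! ### Relatively uniform closure and moduli. -/

section UniformClosure

variable {X : Type*} [AddCommGroup X] [Lattice X] [Module ℝ X] [IsComplexVectorLattice X]

theorem smul_le_smul_of_abs_le {c r : ℝ} {x b : X} (hc : |c| ≤ r) (hx : |x| ≤ b) :
    c • x ≤ r • b := by
  have h : c • x ≤ |c| • |x| := by
    rcases le_total 0 c with h | h
    · rw [abs_of_nonneg h]
      exact smul_le_smul_of_nonneg_left (le_abs_self x) h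
    · rw [abs_of_nonpos h, ← neg_smul_neg]
      exact smul_le_smul_of_nonneg_left (neg_le_abs x) (neg_nonneg.2 h)
  exact h.trans ((smul_le_smul_of_nonneg_right hc (abs_nonneg x)).trans
    (smul_le_smul_of_nonneg_left hx ((abs_nonneg c).trans hc)))

theorem abs_smul_le_smul {c r : ℝ} {x b : X} (hc : |c| ≤ r) (hx : |x| ≤ b) :
    |c • x| ≤ r • b := by
  refine abs_le'.2 ⟨smul_le_smul_of_abs_le hc hx, ?_⟩
  rw [← neg_smul]
  exact smul_le_smul_of_abs_le (by rwa [abs_neg]) hx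

/-- The relatively uniform closure of a subspace. -/
def Submodule.uniformClosure (D : Submodule ℝ X) : Submodule ℝ X where
  carrier := {x | ∃ u ∈ D, ∀ ε : ℝ, 0 < ε → ∃ d ∈ D, |x - d| ≤ ε • u}
  zero_mem' := ⟨0, D.zero_mem, fun _ _ => ⟨0, D.zero_mem, by simp⟩⟩
  add_mem' := by
    rintro x y ⟨u, hu, hx⟩ ⟨v, hv, hy⟩
    refine ⟨u + v, D.add_mem hu hv, fun ε hε => ?_⟩
    obtain ⟨d, hd, hxd⟩ := hx ε hε
    obtain ⟨e, he, hye⟩ := hy ε hε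
    refine ⟨d + e, D.add_mem hd he, ?_⟩
    rw [add_sub_add_comm, smul_add]
    exact (abs_add_le _ _).trans (add_le_add hxd hye)
  smul_mem' := by
    rintro c x ⟨u, hu, hx⟩
    refine ⟨|c| • u, D.smul_mem _ hu, fun ε hε => ?_⟩
    obtain ⟨d, hd, hxd⟩ := hx ε hε
    refine ⟨c • d, D.smul_mem c hd, ?_⟩
    rw [← smul_sub, smul_comm]
    exact abs_smul_le_smul le_rfl hxd

theorem Submodule.le_uniformClosure (D : Submodule ℝ X) : D ≤ D.uniformClosure :=
  fun x hx => ⟨0, D.zero_mem, fun _ _ => ⟨x, hx, by simp⟩⟩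

/-- Compactness gives a finite net, and cosine and sine are 1-Lipschitz. -/
theorem exists_finset_angles {ε : ℝ} (hε : 0 < ε) :
    ∃ t : Finset ℝ, t.Nonempty ∧ (∀ φ ∈ t, φ ∈ Set.Icc 0 (2 * Real.pi)) ∧
      ∀ θ ∈ Set.Icc 0 (2 * Real.pi), ∃ φ ∈ t,
        |Real.cos θ - Real.cos φ| ≤ ε ∧ |Real.sin θ - Real.sin φ| ≤ ε := by
  obtain ⟨t, hts, htf, hcov⟩ :=
    (isCompact_Icc : IsCompact (Set.Icc 0 (2 * Real.pi))).finite_cover_balls hε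
  have key : ∀ θ ∈ Set.Icc 0 (2 * Real.pi), ∃ φ ∈ htf.toFinset, |θ - φ| < ε := by
    intro θ hθ
    obtain ⟨φ, hφ, h⟩ := Set.mem_iUnion₂.1 (hcov hθ)
    exact ⟨φ, htf.mem_toFinset.2 hφ, h⟩
  refine ⟨htf.toFinset, ?_, fun φ hφ => hts (htf.mem_toFinset.1 hφ), fun θ hθ => ?_⟩
  · obtain ⟨φ, hφ, -⟩ := key 0 ⟨le_rfl, by positivity⟩
    exact ⟨φ, hφ⟩
  · obtain ⟨φ, hφ, h⟩ := key θ hθ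
    exact ⟨φ, hφ, (Real.abs_cos_sub_cos_le θ φ).trans h.le,
      (Real.abs_sin_sub_sin_le θ φ).trans h.le⟩

/-- The modulus is approximated by the supremum over a finite net of angles, with `x` and `y`
replaced by approximants from `D`. -/
theorem Submodule.modulus_mem_uniformClosure {D : Submodule ℝ X} (hD : SupClosed (D : Set X))
    {x y : X} (hx : x ∈ D.uniformClosure) (hy : y ∈ D.uniformClosure) :
    Cplx.modulus ⟨x, y⟩ ∈ D.uniformClosure := by
  have hbound : ∀ x u : X, u ∈ D → (∀ ε : ℝ, 0 < ε → ∃ d ∈ D, |x - d| ≤ ε • u) →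
      ∃ b ∈ D, |x| ≤ b := by
    intro x u hu h
    obtain ⟨d, hd, hxd⟩ := h 1 one_pos
    refine ⟨u + |d|, D.add_mem hu (hD hd (D.neg_mem hd)), ?_⟩
    rw [one_smul] at hxd
    calc |x| = |x - d + d| := by rw [sub_add_cancel]
      _ ≤ |x - d| + |d| := abs_add_le _ _
      _ ≤ u + |d| := by gcongr
  obtain ⟨u, hu, hx⟩ := hx
  obtain ⟨v, hv, hy⟩ := hy
  obtain ⟨a, ha, hxa⟩ := hbound x u hu hx
  obtain ⟨b, hb, hyb⟩ := hbound y v hv hy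
  have hm := Cplx.isLUB_modulus (⟨x, y⟩ : Cplx X)
  -- In the regulator, `u + v` pays for replacing `x, y` by `d, e`, and `a + b` for replacing an
  -- angle by a nearby one of the net.
  refine ⟨u + v + (a + b), D.add_mem (D.add_mem hu hv) (D.add_mem ha hb), fun ε hε => ?_⟩
  obtain ⟨d, hd, hxd⟩ := hx ε hε
  obtain ⟨e, he, hye⟩ := hy ε hε
  obtain ⟨t, ht, htI, hcov⟩ := exists_finset_angles hε
  refine ⟨t.sup' ht fun φ => Real.cos φ • d + Real.sin φ • e, hD.finsetSup'_mem ht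
    fun φ _ => D.add_mem (D.smul_mem _ hd) (D.smul_mem _ he), abs_le'.2 ⟨?_, ?_⟩⟩
  · rw [sub_le_iff_le_add']
    refine hm.2 ?_
    rintro _ ⟨θ, hθ, rfl⟩
    obtain ⟨φ, hφ, hc, hs⟩ := hcov θ hθ
    calc Real.cos θ • x + Real.sin θ • y
        = Real.cos φ • d + Real.sin φ • e + (Real.cos φ • (x - d) + Real.sin φ • (y - e) +
          ((Real.cos θ - Real.cos φ) • x + (Real.sin θ - Real.sin φ) • y)) := by module
      _ ≤ (t.sup' ht fun φ => Real.cos φ • d + Real.sin φ • e) +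
          ((1 : ℝ) • ε • u + (1 : ℝ) • ε • v + (ε • a + ε • b)) := by
        refine add_le_add (Finset.le_sup' (fun φ => Real.cos φ • d + Real.sin φ • e) hφ)
          (add_le_add (add_le_add ?_ ?_) (add_le_add ?_ ?_))
        · exact smul_le_smul_of_abs_le (Real.abs_cos_le_one φ) hxd
        · exact smul_le_smul_of_abs_le (Real.abs_sin_le_one φ) hye
        · exact smul_le_smul_of_abs_le hc hxa
        · exact smul_le_smul_of_abs_le hs hyb
      _ = _ := by module
  · rw [neg_sub, sub_le_iff_le_add']
    refine Finset.sup'_le _ _ fun φ hφ => ?_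
    have ha0 : 0 ≤ a + b := add_nonneg ((abs_nonneg x).trans hxa) ((abs_nonneg y).trans hyb)
    calc Real.cos φ • d + Real.sin φ • e
        = Real.cos φ • x + Real.sin φ • y +
          (Real.cos φ • (d - x) + Real.sin φ • (e - y) + ε • (0 : X)) := by module
      _ ≤ Cplx.modulus ⟨x, y⟩ + ((1 : ℝ) • ε • u + (1 : ℝ) • ε • v + ε • (a + b)) := by
        refine add_le_add (hm.1 ⟨φ, htI φ hφ, rfl⟩) (add_le_add (add_le_add ?_ ?_) ?_)
        · exact smul_le_smul_of_abs_le (Real.abs_cos_le_one φ) (by rwa [abs_sub_comm])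
        · exact smul_le_smul_of_abs_le (Real.abs_sin_le_one φ) (by rwa [abs_sub_comm])
        · exact smul_le_smul_of_nonneg_left ha0 hε.le
      _ = _ := by module

/-- The regulator `u` lies in the lattice span itself, so the sign implication applies to `d - ε •
u`. This bounds `w.2` by arbitrarily small multiples of `u.2`; the same holds for `-w`. -/
theorem Submodule.snd_eq_zero_of_mem_uniformClosure {Q : Type*} [AddCommGroup Q] [Module ℝ Q]
    {M : Submodule ℝ ((Q → ℝ) × X)} (hX : IsArchimedeanVL X)
    (hlin : ∀ m ∈ M, ∃ l : Q →ₗ[ℝ] ℝ, m.1 = l) (hzero : ∀ m ∈ M, m.1 = 0 → m.2 = 0)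
    {w : (Q → ℝ) × X} (hw : w ∈ M.latticeSpan.uniformClosure) (h : w.1 = 0) : w.2 = 0 := by
  have key : ∀ w ∈ M.latticeSpan.uniformClosure, w.1 = 0 → w.2 ≤ 0 := by
    rintro w ⟨u, hu, hw⟩ h
    have hle : ∀ ε : ℝ, 0 < ε → w.2 ≤ (2 * ε) • u.2 := by
      intro ε hε
      obtain ⟨d, hd, hwd⟩ := hw ε hε
      have h₁ := (abs_le'.1 hwd).1.2
      have h₂ := (abs_le'.1 hwd).2.1
      have h₃ : (d - ε • u).2 ≤ 0 := by
        refine snd_nonpos_of_mem_latticeSpan hlin hzero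
          (M.latticeSpan.sub_mem hd (M.latticeSpan.smul_mem ε hu)) ?_
        simpa [h] using h₂
      rw [Prod.snd_sub, sub_nonpos] at h₃
      rw [Prod.snd_sub, sub_le_iff_le_add'] at h₁
      refine (h₁.trans (add_le_add_left h₃ _)).trans_eq ?_
      rw [Prod.smul_snd]
      module
    refine hX w.2 u.2 fun n => ?_
    rcases n.eq_zero_or_pos with rfl | hn
    -- For `n = 0` the claim is `0 ≤ u.2`, which holds because `u` dominates an absolute value.
    · obtain ⟨d, -, hwd⟩ := hw 1 one_pos
      have := ((abs_nonneg _).trans hwd).2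
      simpa using this
    · have hn' : (0 : ℝ) < n := Nat.cast_pos.2 hn
      have h₁ := smul_le_smul_of_nonneg_left (hle (1 / (2 * n)) (by positivity)) hn'.le
      rwa [smul_smul, show (n : ℝ) * (2 * (1 / (2 * n))) = 1 by field_simp, one_smul,
        Nat.cast_smul_eq_nsmul] at h₁
  refine le_antisymm (key w hw h) ?_
  have := key (-w) (Submodule.neg_mem _ hw) (by simp [h])
  simpa using this

end UniformClosure

/-! ### The free Archimedean complex vector lattice. -/

section FreeArchimedean

variable {A : Type u}

theorem isArchimedeanVL_fvlC : IsArchimedeanVL (fvlC A).realPart := by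
  intro x y h q
  by_contra! hlt
  obtain ⟨n, hn⟩ := Archimedean.arch ((y : (Signed A × Signed A → ℝ) → ℝ) q + 1) hlt
  have h₁ : n • (x : (Signed A × Signed A → ℝ) → ℝ) q ≤
      (y : (Signed A × Signed A → ℝ) → ℝ) q := h n q
  linarith

/-- The coordinates of `ℝ^(±A × ±A)` that occur in the generators. -/
def genCoord : A ⊕ A → Signed A × Signed A
  | Sum.inl a => (Sum.inl a, Sum.inl a)
  | Sum.inr a => (Sum.inr a, Sum.inl a)

/-- This makes the parts of the generators linearly independent, so no linear relation constrains
`T`. -/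
theorem genCoord_injective : Function.Injective (genCoord (A := A)) := by
  rintro (a | a) (b | b) h <;> simp_all [genCoord]

section

variable {V : Type v} (T : A → Cplx V)

/-- The generators of the graph of the homomorphism extending `T`. -/
def graphGen (a : A) : Cplx (((Signed A × Signed A → ℝ) → ℝ) × V) :=
  ⟨((genElem a).re, (T a).re), ((genElem a).im, (T a).im)⟩

/-- The real and imaginary parts of the generators of the graph. -/
def graphPart : A ⊕ A → ((Signed A × Signed A → ℝ) → ℝ) × V
  | Sum.inl a => (graphGen T a).re
  | Sum.inr a => (graphGen T a).im

theorem graphPart_fst (i : A ⊕ A) (q : Signed A × Signed A → ℝ) :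
    (graphPart T i).1 q = q (genCoord i) := by
  cases i <;> rfl

end

variable {V : Type v} [AddCommGroup V] [Module ℝ V] (T : A → Cplx V)

theorem linearCombination_graphPart_fst (c : A ⊕ A →₀ ℝ) (q : Signed A × Signed A → ℝ) :
    (Finsupp.linearCombination ℝ (graphPart T) c).1 q =
      ∑ i ∈ c.support, c i * q (genCoord i) := by
  simp [Finsupp.linearCombination_apply, Finsupp.sum, Prod.fst_sum, graphPart_fst]

variable [Lattice V] [IsComplexVectorLattice V]

theorem snd_eq_zero_of_mem_latC_graphGen (hV : IsArchimedeanVL V)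
    {w : ((Signed A × Signed A → ℝ) → ℝ) × V}
    (hw : w ∈ (latC (Set.range (graphGen T))).realPart) (h : w.1 = 0) : w.2 = 0 := by
  classical
  let M := LinearMap.range (Finsupp.linearCombination ℝ (graphPart T))
  have hM : ∀ i, graphPart T i ∈ M.latticeSpan.uniformClosure := fun i =>
    Submodule.le_uniformClosure _ (Submodule.le_latticeSpan _ ⟨Finsupp.single i 1, by simp⟩)
  refine Submodule.snd_eq_zero_of_mem_uniformClosure (M := M) hV ?_ ?_ ?_ h
  · rintro _ ⟨c, rfl⟩
    refine ⟨∑ i ∈ c.support, c i • LinearMap.proj (genCoord i), ?_⟩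
    ext q
    rw [linearCombination_graphPart_fst]
    simp
  · rintro _ ⟨c, rfl⟩ hc
    have : c = 0 := by
      ext j
      -- Evaluation at the indicator of one coordinate isolates the coefficient `c j`.
      have h₁ := congrFun hc (Pi.single (genCoord j) 1)
      rw [linearCombination_graphPart_fst] at h₁
      simpa [Pi.single_apply, genCoord_injective.eq_iff] using h₁
    simp [this]
  · refine realPart_latC_le (fun x hx y hy =>
      Submodule.modulus_mem_uniformClosure (Submodule.supClosed_latticeSpan _) hx hy) ?_ hw
    rintro _ ⟨a, rfl⟩
    exact ⟨hM (Sum.inl a), hM (Sum.inr a)⟩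

theorem exists_mem_latC_graphGen {f : (Signed A × Signed A → ℝ) → ℝ}
    (hf : f ∈ (fvlC A).realPart) : ∃ w : V, (f, w) ∈ (latC (Set.range (graphGen T))).realPart := by
  have h : (fvlC A).realPart ≤
      (latC (Set.range (graphGen T))).realPart.map (LinearMap.fst ℝ _ V) := by
    refine realPart_latC_le ?_ ?_
    · rintro _ ⟨x, hx, rfl⟩ _ ⟨y, hy, rfl⟩
      refine ⟨_, ComplexSublattice.modulus_mk_mem hx hy, ?_⟩
      rw [Cplx.modulus_prod]
      rfl
    · rintro _ ⟨a, rfl⟩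
      exact ⟨⟨_, re_mem_latC ⟨a, rfl⟩, rfl⟩, ⟨_, im_mem_latC ⟨a, rfl⟩, rfl⟩⟩
  obtain ⟨⟨_, w⟩, hw, rfl⟩ := h hf
  exact ⟨w, hw⟩

theorem exists_CVLHom_fvlC (hV : IsArchimedeanVL V) :
    ∃ S : CVLHom (fvlC A).realPart V, ∀ a, S.toLinearMap (fvlIota a) = T a := by
  choose h hh using fun f : (fvlC A).realPart => exists_mem_latC_graphGen T f.2
  -- Linearity, preservation of moduli and the values on generators all become membership statements
  -- about the graph.
  have huniq : ∀ (f : (fvlC A).realPart) (w : V),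
      ((f : (Signed A × Signed A → ℝ) → ℝ), w) ∈ (latC (Set.range (graphGen T))).realPart →
        h f = w := by
    intro f w hw
    have h₁ := snd_eq_zero_of_mem_latC_graphGen T hV (Submodule.sub_mem _ (hh f) hw)
      (by simp)
    exact sub_eq_zero.1 h₁
  let l : (fvlC A).realPart →ₗ[ℝ] V :=
    { toFun := h
      map_add' := fun f g => huniq _ _ (Submodule.add_mem _ (hh f) (hh g))
      map_smul' := fun c f => huniq _ _ (Submodule.smul_mem _ c (hh f)) }
  refine ⟨CVLHom.ofReal l fun z => huniq _ _ ?_, fun a => Cplx.ext ?_ ?_⟩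
  · have h₁ := ComplexSublattice.modulus_mk_mem (hh z.re) (hh z.im)
    rw [Cplx.modulus_prod] at h₁
    rwa [ComplexSublattice.coe_modulus]
  · exact huniq _ _ (re_mem_latC (S := Set.range (graphGen T)) ⟨a, rfl⟩)
  · exact huniq _ _ (im_mem_latC (S := Set.range (graphGen T)) ⟨a, rfl⟩)

theorem isFreeArchimedeanCVL_fvlIota :
    IsFreeArchimedeanCVL.{v} (fvlIota : A → Cplx (fvlC A).realPart) := by
  refine ⟨isArchimedeanVL_fvlC, fun V _ _ _ _ hV T => ?_⟩
  obtain ⟨S, hS⟩ := exists_CVLHom_fvlC T hV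
  exact ⟨S, hS, fun S' hS' => CVLHom.latC_ext fun a => (hS' a).trans (hS a).symm⟩

end FreeArchimedean

theorem mainTheorem11 (A : Type u) [Nonempty A] :
    (∃ (F : Type u) (_ : AddCommGroup F) (_ : Lattice F) (_ : Module ℝ F)
        (_ : IsComplexVectorLattice F) (ι : A → Cplx F), IsFreeCVL.{v} ι) ∧
      IsFreeArchimedeanCVL.{v} (fvlIota : A → Cplx (fvlC A).realPart) := by
  exact ⟨exists_isFreeCVL A, isFreeArchimedeanCVL_fvlIota⟩
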